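/- Let $n\ge 2$ be an integer, let $\mathcal H$ be a complex Hilbert space, and let $A=(A_1,\dots,A_n)$ be an $n$-tuple of bounded operators on $\mathcal H$, not all zero, which is a row contraction, i.e. $\sum_{i=1}^n A_iA_i^*\le I$. Put $\Phi(X)=\sum_{i=1}^n A_iXA_i^*$ for bounded operators $X$ on $\mathcal H$. Suppose that $A$ is pure, i.e. $\Phi^k(I)\to 0$ in the strong operator topology as $k\to\infty$, and that its pure rank $$\operatorname{pure\,rank}(A)=\operatorname{rk}\Bigl(I-\sum_{i=1}^n A_iA_i^*\Bigr)$$ is finite. Then the limit $$K(A)=(n-1)\lim_{k\to\infty}\frac{\operatorname{tr}\bigl(I-\Phi^k(I)\bigr)}{n^k}$$ (the curvature invariant of $A$) exists, and the following are equivalent: (i) $K(A)=\operatorname{pure\,rank}(A)$; (ii) $A$ is free, i.e. there are a positive integer $\alpha$ and a unitary $U:\mathcal H\to\ell^2(\mathcal F_n)^{(\alpha)}$ such that $UA_iU^*=L_i^{(\alpha)}$ for $i=1,\dots,n$. Here $\mathcal F_n$ is the unital free semigroup on $n$ generators $1,\dots,n$; $\ell^2(\mathcal F_n)$ is full Fock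 space, with orthonormal basis $\{\xi_w : w\in\mathcal F_n\}$; $L_1,\dots,L_n$ are the left creation operators, the isometries of $\ell^2(\mathcal F_n)$ with $L_i\xi_w=\xi_{iw}$; and $\ell^2(\mathcal F_n)^{(\alpha)}$, $L_i^{(\alpha)}$ denote the direct sums of $\alpha$ copies of $\ell^2(\mathcal F_n)$ and of $L_i$. -/

import Mathlib

open Filter Topology
open scoped ENNReal InnerProductSpace

noncomputable section

namespace RowContraction

variable {H : Type*} [NormedAddCommGroup H] [InnerProductSpace ℂ H] [CompleteSpace H] {n : ℕ}

/-! ### Row contractions -/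

/-- The completely positive map `Φ_A(X) = ∑ i, A i X (A i)*`. -/
def cpMap (A : Fin n → H →L[ℂ] H) (X : H →L[ℂ] H) : H →L[ℂ] H :=
  ∑ i, A i * X * star (A i)

/-- `A` is a (row) contraction: `∑ i, A i (A i)* ≤ 1` in the order of positive operators. -/
def IsRowContraction (A : Fin n → H →L[ℂ] H) : Prop :=
  ∑ i, A i * star (A i) ≤ 1

/-- `A` is pure: `Φ_A^k(1) → 0` in the strong operator topology. -/
def IsPure (A : Fin n → H →L[ℂ] H) : Prop :=
  ∀ x : H, Tendsto (fun k : ℕ => ((cpMap A)^[k] 1) x) atTop (𝓝 0)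

/-- The pure rank of `A`, the rank of the defect operator `1 - ∑ i, A i (A i)*`
(with value `⊤` if the rank is infinite). -/
def pureRank (A : Fin n → H →L[ℂ] H) : ℕ∞ :=
  Cardinal.toENat (LinearMap.rank ((1 - ∑ i, A i * star (A i) : H →L[ℂ] H) : H →ₗ[ℂ] H))

/-! ### The pure rank as a multiplicity in the minimal isometric dilation -/

/-- `S`, acting on `K`, is a minimal isometric dilation of `A` (with `H` embedded in `K` by `V`):
the `S i` are isometries with pairwise orthogonal ranges, `H` is co-invariant with
`(S i)* |_H = (A i)*`, and the subspaces `S_w H`, `w` a word, span a dense subspace of `K`. -/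
structure IsMinimalIsometricDilation {K : Type*} [NormedAddCommGroup K] [InnerProductSpace ℂ K]
    [CompleteSpace K] (A : Fin n → H →L[ℂ] H) (V : H →ₗᵢ[ℂ] K) (S : Fin n → K →L[ℂ] K) :
    Prop where
  isometric : ∀ i j, star (S i) * S j = if i = j then 1 else 0
  coinvariant : ∀ i x, (star (S i)) (V x) = V ((star (A i)) x)
  minimal : (Submodule.span ℂ {y : K | ∃ (w : List (Fin n)) (x : H),
    y = (w.map S).prod (V x)}).topologicalClosure = ⊤

/-- The rank of the defect operator of `A` is the multiplicity of the left regular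
representation in any minimal isometric dilation of `A`. -/
theorem pureRank_eq_of_dilation {K : Type*} [NormedAddCommGroup K] [InnerProductSpace ℂ K]
    [CompleteSpace K] {A : Fin n → H →L[ℂ] H} {V : H →ₗᵢ[ℂ] K} {S : Fin n → K →L[ℂ] K}
    (h : IsMinimalIsometricDilation A V S) : pureRank A = pureRank S := by
  set D : H →L[ℂ] H := 1 - ∑ i, A i * star (A i) with hD
  set P : K →L[ℂ] K := 1 - ∑ i, S i * star (S i) with hP
  set Q : H →L[ℂ] K := P ∘L V.toContinuousLinearMap with hQ
  have hPS : ∀ j, P * S j = 0 := by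
    intro j
    rw [hP, sub_mul, one_mul, Finset.sum_mul, sub_eq_zero]
    simp_rw [mul_assoc, h.isometric]
    simp
  have hPx : ∀ x y, ⟪V x, P (V y)⟫_ℂ = ⟪x, D y⟫_ℂ := by
    intro x y
    simp only [hP, hD, sub_apply, one_apply_eq_self,
      sum_apply, mul_apply_eq_comp, inner_sub_right, inner_sum,
      V.inner_map_map]
    congr 1
    refine Finset.sum_congr rfl fun i _ => ?_
    rw [← ContinuousLinearMap.adjoint_inner_left, ← ContinuousLinearMap.adjoint_inner_left (A i),
      ← ContinuousLinearMap.star_eq_adjoint, ← ContinuousLinearMap.star_eq_adjoint,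
      h.coinvariant, h.coinvariant, V.inner_map_map]
  have hPP : star P * P = P := by
    have hs : star P = P := by simp [hP]
    rw [hs]
    nth_rewrite 2 [hP]
    rw [mul_sub, mul_one, Finset.mul_sum]
    simp_rw [← mul_assoc, hPS]
    simp
  have hker : LinearMap.ker (Q : H →ₗ[ℂ] K) = LinearMap.ker (D : H →ₗ[ℂ] H) := by
    ext x
    have hQx : Q x = P (V x) := rfl
    simp only [LinearMap.mem_ker, ContinuousLinearMap.coe_coe]
    constructor
    · intro hx
      refine ext_inner_left ℂ fun y => ?_
      rw [← hPx, ← hQx, hx, inner_zero_right, inner_zero_right]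
    · intro hx
      rw [← inner_self_eq_zero (𝕜 := ℂ), hQx, ← ContinuousLinearMap.adjoint_inner_right,
        ← ContinuousLinearMap.star_eq_adjoint, ← mul_apply_eq_comp, hPP, hPx, hx,
        inner_zero_right]
  let e : LinearMap.range (Q : H →ₗ[ℂ] K) ≃ₗ[ℂ] LinearMap.range (D : H →ₗ[ℂ] H) :=
    (Q : H →ₗ[ℂ] K).quotKerEquivRange.symm ≪≫ₗ Submodule.quotEquivOfEq _ _ hker ≪≫ₗ
      (D : H →ₗ[ℂ] H).quotKerEquivRange
  have hle : LinearMap.range (Q : H →ₗ[ℂ] K) ≤ LinearMap.range (P : K →ₗ[ℂ] K) := by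
    rintro _ ⟨x, rfl⟩
    exact ⟨V x, rfl⟩
  have hclos : LinearMap.range (P : K →ₗ[ℂ] K) ≤
      (LinearMap.range (Q : H →ₗ[ℂ] K)).topologicalClosure := by
    rintro _ ⟨y, rfl⟩
    have hy : y ∈ (Submodule.span ℂ {y : K | ∃ (w : List (Fin n)) (x : H),
        y = (w.map S).prod (V x)}).topologicalClosure := by rw [h.minimal]; trivial
    refine map_mem_closure (t := (LinearMap.range (Q : H →ₗ[ℂ] K) : Set K)) P.continuous hy ?_
    intro z hz
    suffices Submodule.span ℂ {y : K | ∃ (w : List (Fin n)) (x : H),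
        y = (w.map S).prod (V x)} ≤ (LinearMap.range (Q : H →ₗ[ℂ] K)).comap (P : K →ₗ[ℂ] K) from
      this hz
    rw [Submodule.span_le]
    rintro _ ⟨w, x, rfl⟩
    cases w with
    | nil => exact ⟨x, by simp [hQ]⟩
    | cons i w =>
      refine ⟨0, ?_⟩
      have h0 : P ((S i) ((w.map S).prod (V x))) = 0 := by
        rw [← mul_apply_eq_comp, hPS]; rfl
      simpa using h0.symm
  have hrk : Cardinal.toENat (LinearMap.rank (D : H →ₗ[ℂ] H)) =
      Cardinal.toENat (Module.rank ℂ (LinearMap.range (Q : H →ₗ[ℂ] K))) := by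
    rw [LinearMap.rank, ← Cardinal.toENat_lift, ← e.lift_rank_eq, Cardinal.toENat_lift]
  change Cardinal.toENat (LinearMap.rank (D : H →ₗ[ℂ] H)) =
    Cardinal.toENat (LinearMap.rank (P : K →ₗ[ℂ] K))
  rw [hrk, LinearMap.rank]
  by_cases hfin : Module.Finite ℂ (LinearMap.range (Q : H →ₗ[ℂ] K))
  · have hcl : IsClosed (LinearMap.range (Q : H →ₗ[ℂ] K) : Set K) :=
      Submodule.closed_of_finiteDimensional _
    rw [hcl.submodule_topologicalClosure_eq] at hclos
    rw [le_antisymm hle hclos]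
  · rw [Cardinal.toENat_eq_top.mpr, Cardinal.toENat_eq_top.mpr]
    · exact (not_lt.mp fun hlt => hfin (Module.rank_lt_aleph0_iff.mp hlt)).trans
        (Submodule.rank_mono hle)
    · exact not_lt.mp fun hlt => hfin (Module.rank_lt_aleph0_iff.mp hlt)

/-! ### The trace of a positive operator -/

/-- The sum `∑ ⟨e, T e⟩` over a Hilbert basis, in `[0, ∞]`. -/
def traceAlong {ι : Type*} (b : HilbertBasis ι ℂ H) (T : H →L[ℂ] H) : ℝ≥0∞ :=
  ∑' i, ENNReal.ofReal (⟪b i, T (b i)⟫_ℂ).re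

/-- The trace, with values in `[0, ∞]`, of a positive operator: the sum of the diagonal entries
with respect to a Hilbert basis; see `trace_eq_traceAlong` for the independence of the basis. -/
def trace (T : H →L[ℂ] H) : ℝ≥0∞ :=
  traceAlong (exists_hilbertBasis ℂ H).choose_spec.choose T

theorem ofReal_norm_sq_eq_tsum {ι : Type*} (b : HilbertBasis ι ℂ H) (x : H) :
    ENNReal.ofReal (‖x‖ ^ 2) = ∑' i, ENNReal.ofReal (‖⟪b i, x⟫_ℂ‖ ^ 2) := by
  have h : HasSum (fun i => ‖⟪b i, x⟫_ℂ‖ ^ 2) (‖x‖ ^ 2) := by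
    have h1 := Complex.reCLM.hasSum (b.hasSum_inner_mul_inner x x)
    convert h1 using 1
    · funext i
      rw [Complex.reCLM_apply, ← inner_conj_symm x (b i),
        Complex.conj_mul', ← Complex.ofReal_pow, Complex.ofReal_re]
    · rw [Complex.reCLM_apply, inner_self_eq_norm_sq_to_K]
      norm_cast
  rw [← h.tsum_eq, ENNReal.ofReal_tsum_of_nonneg (fun i => by positivity) h.summable]

theorem traceAlong_star_mul_self {ι κ : Type*} (b : HilbertBasis ι ℂ H) (c : HilbertBasis κ ℂ H)
    (S : H →L[ℂ] H) :
    traceAlong b (star S * S) = ∑' j, ENNReal.ofReal (‖(star S) (c j)‖ ^ 2) := by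
  have h1 : ∀ i, ENNReal.ofReal (⟪b i, (star S * S) (b i)⟫_ℂ).re =
      ∑' j, ENNReal.ofReal (‖⟪c j, S (b i)⟫_ℂ‖ ^ 2) := by
    intro i
    rw [← ofReal_norm_sq_eq_tsum c, mul_apply_eq_comp,
      ContinuousLinearMap.star_eq_adjoint, ContinuousLinearMap.adjoint_inner_right,
      inner_self_eq_norm_sq_to_K]
    norm_cast
  have h2 : ∀ j, ENNReal.ofReal (‖(star S) (c j)‖ ^ 2) =
      ∑' i, ENNReal.ofReal (‖⟪c j, S (b i)⟫_ℂ‖ ^ 2) := by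
    intro j
    rw [ofReal_norm_sq_eq_tsum b]
    congr 1
    funext i
    rw [ContinuousLinearMap.star_eq_adjoint, ContinuousLinearMap.adjoint_inner_right,
      norm_inner_symm]
  simp only [traceAlong, h1, h2]
  exact ENNReal.tsum_comm

/-- The trace of a positive operator may be computed with any Hilbert basis. -/
theorem trace_eq_traceAlong {ι : Type*} (b : HilbertBasis ι ℂ H) {T : H →L[ℂ] H} (hT : 0 ≤ T) :
    trace T = traceAlong b T := by
  obtain ⟨S, rfl⟩ := CStarAlgebra.nonneg_iff_eq_star_mul_self.mp hT
  rw [trace, traceAlong_star_mul_self _ b, traceAlong_star_mul_self b b]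

/-! ### The curvature invariant -/

/-- The sequence `(n - 1) tr(1 - Φ_A^k(1)) / n^k`. -/
def curvatureSeq (A : Fin n → H →L[ℂ] H) (k : ℕ) : ℝ≥0∞ :=
  ((n : ℝ≥0∞) - 1) * (trace (1 - (cpMap A)^[k] 1) / (n : ℝ≥0∞) ^ k)

/-- The curvature invariant `K(A)`, the limit of `curvatureSeq A`. -/
def curvature (A : Fin n → H →L[ℂ] H) : ℝ≥0∞ :=
  limUnder atTop (curvatureSeq A)

/-! ### Full Fock space and freeness -/

/-- Full Fock space `ℓ²(F_n)`, where `F_n` is the unital free semigroup on `n` generators. -/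
abbrev Fock (n : ℕ) : Type := lp (fun _ : FreeMonoid (Fin n) => ℂ) 2

open Classical in
/-- The standard basis vector `ξ_w`. -/
def xi (w : FreeMonoid (Fin n)) : Fock n := lp.single 2 w 1

theorem xi_orthonormal : Orthonormal ℂ (xi : FreeMonoid (Fin n) → Fock n) := by
  classical
  rw [orthonormal_iff_ite]
  intro v w
  rw [xi, xi, lp.inner_single_left, lp.single_apply]
  by_cases h : v = w
  · subst h; simp
  · simp [h]

theorem xi_cons_orthonormal (i : Fin n) :
    Orthonormal ℂ (fun w : FreeMonoid (Fin n) => xi (FreeMonoid.of i * w)) :=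
  xi_orthonormal.comp _ (mul_right_injective (FreeMonoid.of i))

/-- The left creation operator `L_i`, the isometry with `L_i ξ_w = ξ_{iw}`; see `creation_xi`. -/
def creation (i : Fin n) : Fock n →L[ℂ] Fock n :=
  (xi_cons_orthonormal i).orthogonalFamily.linearIsometry.toContinuousLinearMap

theorem creation_xi (i : Fin n) (w : FreeMonoid (Fin n)) :
    creation i (xi w) = xi (FreeMonoid.of i * w) := by
  rw [creation, LinearIsometry.coe_toContinuousLinearMap, xi,
    OrthogonalFamily.linearIsometry_apply_single]
  simp

/-- The direct sum `T^(α)` of `α` copies of `T`, acting on the Hilbert space `H^α`. -/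
def ampliation (α : ℕ) (T : H →L[ℂ] H) :
    PiLp 2 (fun _ : Fin α => H) →L[ℂ] PiLp 2 (fun _ : Fin α => H) :=
  ((PiLp.continuousLinearEquiv 2 ℂ (fun _ : Fin α => H)).symm :
      (Fin α → H) →L[ℂ] PiLp 2 (fun _ : Fin α => H)) ∘L
    ContinuousLinearMap.piMap (fun _ : Fin α => T) ∘L
      (PiLp.continuousLinearEquiv 2 ℂ (fun _ : Fin α => H) :
        PiLp 2 (fun _ : Fin α => H) →L[ℂ] (Fin α → H))

theorem ampliation_apply (α : ℕ) (T : H →L[ℂ] H) (x : PiLp 2 (fun _ : Fin α => H)) (j : Fin α) :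
    ampliation α T x j = T (x j) := rfl

/-- Simultaneous unitary equivalence of two `n`-tuples of operators. -/
def UnitarilyEquivalent {K : Type*} [NormedAddCommGroup K] [InnerProductSpace ℂ K]
    (A : Fin n → H →L[ℂ] H) (B : Fin n → K →L[ℂ] K) : Prop :=
  ∃ U : H ≃ₗᵢ[ℂ] K, ∀ i x, U (A i x) = B i (U x)

/-- `A` is free: it is unitarily equivalent to `L^(α) = (L_1^(α), …, L_n^(α))` for some positive
integer `α`. -/
def IsFree (A : Fin n → H →L[ℂ] H) : Prop :=
  ∃ α : ℕ, 0 < α ∧ UnitarilyEquivalent A (fun i : Fin n => ampliation α (creation i))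

end RowContraction

end

namespace RowContraction

variable {H : Type*} [NormedAddCommGroup H] [InnerProductSpace ℂ H] [CompleteSpace H] {n : ℕ}

/-! ### Properties of the trace -/

/-! Write `D = I - Φ(I)` for the defect and `r` for its rank. Telescoping gives `I - Φ^k(I) =
∑_{j<k} Φ^j(D)`. Each `A_i` is a contraction, so `tr Φ(X) ≤ n tr X` for `X ≥ 0`, and `tr Φ^k(D) /
n^k` decreases. The curvature sequence is essentially an average of these ratios with weights `n^j`,
so it converges to their infimum (`IsRowContraction.tendsto_curvatureSeq`).

Since `0 ≤ D ≤ P`, with `P` the projection onto the range of `D`, this yields `K(A) ≤ tr D ≤ r`. If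
`K(A) = r`, every ratio equals `r`. At `k = 0` this forces `D = P`. At level `k` it makes the `n^k
r` vectors `A_w c_i`, with `|w| = k` and `c` an orthonormal basis of the range of `D`, all of norm
one (`IsRowContraction.norm_wordProd_apply_eq_one`). Purity gives Parseval's identity for the family
of all `A_w c_i` (`IsPure.tsum_norm_inner_wordProd`), and unit vectors satisfying Parseval form an
orthonormal basis. The `A_j` permute this basis as the creation operators do, so `A` is free.

Conversely, for a free tuple the `A_i` are isometries with orthogonal ranges, so `D` is a
projection, `Φ` multiplies traces by exactly `n`, and all the ratios equal `r`. -/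

theorem re_inner_nonneg {T : H →L[ℂ] H} (hT : 0 ≤ T) (x : H) : 0 ≤ (⟪x, T x⟫_ℂ).re :=
  ((ContinuousLinearMap.nonneg_iff_isPositive T).mp hT).re_inner_nonneg_right x

theorem star_mul_mul_nonneg {X : H →L[ℂ] H} (hX : 0 ≤ X) (B : H →L[ℂ] H) :
    0 ≤ B * X * star B :=
  star_right_conjugate_nonneg hX B

theorem trace_add {S T : H →L[ℂ] H} (hS : 0 ≤ S) (hT : 0 ≤ T) :
    trace (S + T) = trace S + trace T := by
  rw [trace, trace, trace, traceAlong, traceAlong, traceAlong, ← ENNReal.tsum_add]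
  refine tsum_congr fun i => ?_
  rw [← ENNReal.ofReal_add (re_inner_nonneg hS _) (re_inner_nonneg hT _), add_apply,
    inner_add_right, Complex.add_re]

theorem trace_zero : trace (0 : H →L[ℂ] H) = 0 := by
  simp [trace, traceAlong]

theorem trace_sum {ι : Type*} (s : Finset ι) (T : ι → H →L[ℂ] H) (hT : ∀ i ∈ s, 0 ≤ T i) :
    trace (∑ i ∈ s, T i) = ∑ i ∈ s, trace (T i) := by
  classical
  induction s using Finset.induction_on with
  | empty => simp [trace_zero]
  | insert a s ha ih =>
    rw [Finset.sum_insert ha, Finset.sum_insert ha, trace_add (hT a (by simp))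
      (Finset.sum_nonneg fun i hi => hT i (by simp [hi])), ih fun i hi => hT i (by simp [hi])]

theorem trace_mono {S T : H →L[ℂ] H} (hS : 0 ≤ S) (hST : S ≤ T) : trace S ≤ trace T := by
  have h := trace_add hS (sub_nonneg.mpr hST)
  rw [add_sub_cancel] at h
  rw [h]
  exact le_self_add

/-- Putting `B` outermost in the norm reduces the comparison of `tr(B X B*)` with `tr X`, for `B`
contractive or isometric, to a comparison term by term. -/
theorem trace_mul_mul_star {ι : Type*} (b : HilbertBasis ι ℂ H) (B S : H →L[ℂ] H) :
    trace (B * (star S * S) * star B) = ∑' i, ENNReal.ofReal (‖B ((star S) (b i))‖ ^ 2) := by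
  have h : B * (star S * S) * star B = star (S * star B) * (S * star B) := by
    simp [mul_assoc]
  rw [trace_eq_traceAlong b (star_mul_mul_nonneg (star_mul_self_nonneg S) B), h,
    traceAlong_star_mul_self b b]
  simp

theorem trace_conj_le {X : H →L[ℂ] H} (hX : 0 ≤ X) {B : H →L[ℂ] H} (hB : ‖B‖ ≤ 1) :
    trace (B * X * star B) ≤ trace X := by
  obtain ⟨_, b, -⟩ := exists_hilbertBasis ℂ H
  obtain ⟨S, rfl⟩ := CStarAlgebra.nonneg_iff_eq_star_mul_self.mp hX
  have h1 := trace_mul_mul_star b 1 S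
  rw [one_mul, star_one, mul_one] at h1
  rw [trace_mul_mul_star b, h1]
  refine ENNReal.tsum_le_tsum fun i => ENNReal.ofReal_le_ofReal ?_
  have := B.le_of_opNorm_le hB ((star S) (b i))
  rw [one_mul] at this
  simpa using pow_le_pow_left₀ (norm_nonneg _) this 2

theorem trace_conj_of_isometry {X : H →L[ℂ] H} (hX : 0 ≤ X) {B : H →L[ℂ] H}
    (hB : star B * B = 1) : trace (B * X * star B) = trace X := by
  obtain ⟨_, b, -⟩ := exists_hilbertBasis ℂ H
  obtain ⟨S, rfl⟩ := CStarAlgebra.nonneg_iff_eq_star_mul_self.mp hX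
  have h1 := trace_mul_mul_star b 1 S
  rw [one_mul, star_one, mul_one] at h1
  rw [trace_mul_mul_star b, h1]
  refine tsum_congr fun i => ?_
  have hn : ∀ x, ‖B x‖ = ‖x‖ :=
    (ContinuousLinearMap.norm_map_iff_adjoint_comp_self B).mpr hB
  rw [hn]
  simp

theorem eq_zero_of_trace_eq_zero {T : H →L[ℂ] H} (hT : 0 ≤ T) (h : trace T = 0) : T = 0 := by
  obtain ⟨_, b, -⟩ := exists_hilbertBasis ℂ H
  obtain ⟨S, rfl⟩ := CStarAlgebra.nonneg_iff_eq_star_mul_self.mp hT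
  rw [trace_eq_traceAlong b hT, traceAlong_star_mul_self b b, ENNReal.tsum_eq_zero] at h
  have hS : star S = 0 := by
    refine ContinuousLinearMap.ext_on
      (Submodule.dense_iff_topologicalClosure_eq_top.mpr b.dense_span) ?_
    rintro _ ⟨i, rfl⟩
    have := h i
    rw [ENNReal.ofReal_eq_zero] at this
    simpa using le_antisymm this (by positivity)
  rw [hS, zero_mul]

/-! ### Traces involving a finite-rank projection -/

section Projection

variable {M : Submodule ℂ H} [FiniteDimensional ℂ M] {r : ℕ}

theorem re_inner_conj_starProjection (c : OrthonormalBasis (Fin r) ℂ M) (B : H →L[ℂ] H) (x : H) :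
    (⟪x, (B * M.starProjection * star B) x⟫_ℂ).re = ∑ i, ‖⟪B (c i), x⟫_ℂ‖ ^ 2 := by
  rw [mul_apply_eq_comp, mul_apply_eq_comp, ← ContinuousLinearMap.adjoint_inner_left,
    ← ContinuousLinearMap.star_eq_adjoint]
  obtain ⟨y, hy⟩ : ∃ y, y = (star B) x := ⟨_, rfl⟩
  rw [← hy]
  have h1 : ⟪y, M.starProjection y⟫_ℂ = ⟪M.orthogonalProjectionOnto y,
      M.orthogonalProjectionOnto y⟫_ℂ := by
    rw [Submodule.coe_inner, ← Submodule.starProjection_apply,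
      Submodule.inner_starProjection_left_eq_right, ← mul_apply_eq_comp,
      (Submodule.isIdempotentElem_starProjection M).eq]
  have h2 : (⟪y, M.starProjection y⟫_ℂ).re = ‖M.orthogonalProjectionOnto y‖ ^ 2 := by
    rw [h1, inner_self_eq_norm_sq_to_K]
    norm_cast
  rw [h2, ← c.sum_sq_norm_inner_right]
  refine Finset.sum_congr rfl fun i _ => ?_
  rw [Submodule.inner_orthogonalProjectionOnto_eq_of_mem_left, hy,
    ContinuousLinearMap.star_eq_adjoint, ContinuousLinearMap.adjoint_inner_right]

/-- `B P B*` is the sum of the rank-one operators attached to the vectors `B c_i`, and each has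
trace `‖B c_i‖²`. -/
theorem trace_conj_starProjection (c : OrthonormalBasis (Fin r) ℂ M) (B : H →L[ℂ] H) :
    trace (B * M.starProjection * star B) = ∑ i, ENNReal.ofReal (‖B (c i)‖ ^ 2) := by
  obtain ⟨_, b, -⟩ := exists_hilbertBasis ℂ H
  have hP : 0 ≤ M.starProjection := by
    rw [ContinuousLinearMap.nonneg_iff_isPositive]
    exact .of_isStarProjection isStarProjection_starProjection
  rw [trace_eq_traceAlong b (star_mul_mul_nonneg hP B), traceAlong]
  simp_rw [re_inner_conj_starProjection c]
  simp_rw [ENNReal.ofReal_sum_of_nonneg fun i (_ : i ∈ Finset.univ) =>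
    sq_nonneg ‖⟪B (c i), _⟫_ℂ‖]
  rw [Summable.tsum_finsetSum fun _ _ => ENNReal.summable]
  refine Finset.sum_congr rfl fun i _ => ?_
  rw [ofReal_norm_sq_eq_tsum b]
  simp_rw [norm_inner_symm]

theorem trace_starProjection (c : OrthonormalBasis (Fin r) ℂ M) : trace M.starProjection = r := by
  have h := trace_conj_starProjection c 1
  rw [one_mul, star_one, mul_one] at h
  have hc : ∀ i, ‖(c i : H)‖ = 1 := fun i => c.orthonormal.1 i
  simpa [hc, ← ofReal_norm] using h

end Projection

end RowContraction

namespace RowContraction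

variable {H : Type*} [NormedAddCommGroup H] [InnerProductSpace ℂ H] [CompleteSpace H] {n : ℕ}

/-! ### Words in the coordinates of a tuple, and iterates of `cpMap` -/

/-- The product `A_w` of the coordinates of `A` along the word `w`. -/
noncomputable def wordProd (A : Fin n → H →L[ℂ] H) (w : FreeMonoid (Fin n)) : H →L[ℂ] H :=
  FreeMonoid.lift A w

/-- The word with letters `v 0, …, v (k - 1)`. -/
def tupleWord {k : ℕ} (v : Fin k → Fin n) : FreeMonoid (Fin n) :=
  FreeMonoid.ofList (List.ofFn v)

theorem wordProd_one (A : Fin n → H →L[ℂ] H) : wordProd A 1 = 1 := by simp [wordProd]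

theorem wordProd_of_mul (A : Fin n → H →L[ℂ] H) (i : Fin n) (w : FreeMonoid (Fin n)) :
    wordProd A (FreeMonoid.of i * w) = A i * wordProd A w := by simp [wordProd]

theorem tupleWord_cons {k : ℕ} (i : Fin n) (v : Fin k → Fin n) :
    tupleWord (Fin.cons i v : Fin (k + 1) → Fin n) = FreeMonoid.of i * tupleWord v := by
  rw [tupleWord, List.ofFn_cons, FreeMonoid.ofList_cons, tupleWord]

theorem exists_tupleWord (w : FreeMonoid (Fin n)) :
    ∃ (k : ℕ) (v : Fin k → Fin n), tupleWord v = w := by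
  obtain ⟨⟨k, v⟩, h⟩ := (List.equivSigmaTuple (α := Fin n)).symm.surjective w.toList
  exact ⟨k, v, h⟩

/-- Grouping words by length matches a sum over all words with the iterates of `cpMap` expanded in
`iterate_cpMap`. -/
theorem tsum_freeMonoid (f : FreeMonoid (Fin n) → ℝ≥0∞) :
    ∑' w, f w = ∑' k : ℕ, ∑ v : Fin k → Fin n, f (tupleWord v) := by
  have h := ((List.equivSigmaTuple (α := Fin n)).symm.trans FreeMonoid.ofList).tsum_eq f
  rw [← h, ENNReal.tsum_sigma']
  refine tsum_congr fun k => ?_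
  rw [tsum_fintype]
  rfl

theorem iterate_cpMap (A : Fin n → H →L[ℂ] H) (k : ℕ) (X : H →L[ℂ] H) :
    (cpMap A)^[k] X =
      ∑ v : Fin k → Fin n, wordProd A (tupleWord v) * X * star (wordProd A (tupleWord v)) := by
  induction k with
  | zero =>
    have h : ∀ v : Fin 0 → Fin n, tupleWord v = 1 := fun v => by
      rw [tupleWord, List.ofFn_zero, FreeMonoid.ofList_nil]
    simp [h, wordProd_one]
  | succ k ih =>
    rw [Function.iterate_succ_apply', ih, cpMap,
      ← (Fin.consEquiv fun _ => Fin n).sum_comp, Fintype.sum_prod_type]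
    refine Finset.sum_congr rfl fun i _ => ?_
    rw [Finset.mul_sum, Finset.sum_mul]
    refine Finset.sum_congr rfl fun v _ => ?_
    have h : tupleWord (Fin.consEquiv (fun _ => Fin n) (i, v)) = FreeMonoid.of i * tupleWord v :=
      tupleWord_cons i v
    simp only [h, wordProd_of_mul, star_mul, mul_assoc]

theorem iterate_cpMap_sub (A : Fin n → H →L[ℂ] H) (k : ℕ) (X Y : H →L[ℂ] H) :
    (cpMap A)^[k] (X - Y) = (cpMap A)^[k] X - (cpMap A)^[k] Y := by
  simp only [iterate_cpMap, mul_sub, sub_mul, Finset.sum_sub_distrib]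

theorem iterate_cpMap_nonneg (A : Fin n → H →L[ℂ] H) (k : ℕ) {X : H →L[ℂ] H} (hX : 0 ≤ X) :
    0 ≤ (cpMap A)^[k] X := by
  rw [iterate_cpMap]
  exact Finset.sum_nonneg fun v _ => star_mul_mul_nonneg hX _

/-- The defect operator `1 - ∑ i, A i (A i)*`. -/
noncomputable def defect (A : Fin n → H →L[ℂ] H) : H →L[ℂ] H := 1 - ∑ i, A i * star (A i)

theorem defect_eq (A : Fin n → H →L[ℂ] H) : defect A = 1 - cpMap A 1 := by
  simp [defect, cpMap]

theorem one_sub_iterate_cpMap (A : Fin n → H →L[ℂ] H) (k : ℕ) :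
    1 - (cpMap A)^[k] 1 = ∑ j ∈ Finset.range k, (cpMap A)^[j] (defect A) := by
  induction k with
  | zero => simp
  | succ k ih =>
    rw [Finset.sum_range_succ, ← ih, defect_eq, iterate_cpMap_sub, ← Function.iterate_succ_apply]
    abel

theorem IsRowContraction.defect_nonneg {A : Fin n → H →L[ℂ] H} (hA : IsRowContraction A) :
    0 ≤ defect A := sub_nonneg.mpr hA

theorem defect_le_one (A : Fin n → H →L[ℂ] H) : defect A ≤ 1 :=
  sub_le_self _ (Finset.sum_nonneg fun i _ => mul_star_self_nonneg (A i))

theorem IsRowContraction.norm_le_one {A : Fin n → H →L[ℂ] H} (hA : IsRowContraction A)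
    (i : Fin n) : ‖A i‖ ≤ 1 := by
  have h1 : A i * star (A i) ≤ 1 :=
    (Finset.single_le_sum (f := fun i => A i * star (A i))
      (fun j _ => mul_star_self_nonneg (A j)) (Finset.mem_univ i)).trans hA
  have h2 : ‖A i * star (A i)‖ ≤ 1 :=
    (CStarAlgebra.norm_le_one_iff_of_nonneg _ (mul_star_self_nonneg (A i))).mpr h1
  rw [CStarRing.norm_self_mul_star] at h2
  nlinarith [norm_nonneg (A i)]

theorem IsRowContraction.norm_wordProd_le_one {A : Fin n → H →L[ℂ] H} (hA : IsRowContraction A)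
    (w : FreeMonoid (Fin n)) : ‖wordProd A w‖ ≤ 1 := by
  induction w using FreeMonoid.inductionOn' with
  | one =>
    rw [wordProd_one]
    exact ContinuousLinearMap.norm_id_le
  | of_mul i w ih =>
    rw [wordProd_of_mul]
    exact (norm_mul_le _ _).trans (mul_le_one₀ (hA.norm_le_one i) (norm_nonneg _) ih)

theorem IsRowContraction.trace_cpMap_le {A : Fin n → H →L[ℂ] H} (hA : IsRowContraction A)
    {X : H →L[ℂ] H} (hX : 0 ≤ X) : trace (cpMap A X) ≤ n * trace X := by
  rw [cpMap, trace_sum _ _ fun i _ => star_mul_mul_nonneg hX _]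
  refine (Finset.sum_le_sum fun i _ => trace_conj_le hX (hA.norm_le_one i)).trans ?_
  simp

theorem trace_cpMap_of_isometry {A : Fin n → H →L[ℂ] H} (hA : ∀ i, star (A i) * A i = 1)
    {X : H →L[ℂ] H} (hX : 0 ≤ X) : trace (cpMap A X) = n * trace X := by
  rw [cpMap, trace_sum _ _ fun i _ => star_mul_mul_nonneg hX _]
  simp [trace_conj_of_isometry hX (hA _)]

theorem trace_iterate_cpMap_of_isometry {A : Fin n → H →L[ℂ] H}
    (hA : ∀ i, star (A i) * A i = 1) {X : H →L[ℂ] H} (hX : 0 ≤ X) (k : ℕ) :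
    trace ((cpMap A)^[k] X) = (n : ℝ≥0∞) ^ k * trace X := by
  induction k with
  | zero => simp
  | succ k ih =>
    rw [Function.iterate_succ_apply', trace_cpMap_of_isometry hA (iterate_cpMap_nonneg A k hX),
      ih, pow_succ', mul_assoc]

/-! ### Existence of the curvature invariant -/

/-- The weights `c^j` have total `(c^k - 1)/(c - 1)`, so the expression is `1 - c^(-k)` times a
weighted average of `b`. The total weight diverges, so Cesàro's argument applies. -/
theorem tendsto_geometric_mean {c : ℝ} (hc : 1 < c) {b : ℕ → ℝ} {L : ℝ}
    (hb : Tendsto b atTop (𝓝 L)) :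
    Tendsto (fun k => (c - 1) * ((∑ j ∈ Finset.range k, c ^ j * b j) / c ^ k)) atTop (𝓝 L) := by
  have hc0 : 0 < c := zero_lt_one.trans hc
  have hc1 : c - 1 ≠ 0 := (sub_pos.mpr hc).ne'
  have hg : Tendsto (fun k => ∑ j ∈ Finset.range k, c ^ j) atTop atTop := by
    refine tendsto_atTop_mono (fun k => ?_) tendsto_natCast_atTop_atTop
    simpa using Finset.card_nsmul_le_sum (Finset.range k) (fun j => c ^ j) 1
      fun j _ => one_le_pow₀ hc.le
  have ho : (fun j => c ^ j * (b j - L)) =o[atTop] fun j => c ^ j := by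
    have h1 : (fun j => b j - L) =o[atTop] fun _ => (1 : ℝ) :=
      (Asymptotics.isLittleO_one_iff ℝ).mpr (by simpa using hb.sub_const L)
    simpa using (Asymptotics.isBigO_refl (fun j : ℕ => c ^ j) atTop).mul_isLittleO h1
  have hs := (ho.sum_range (fun j => by positivity) hg).tendsto_div_nhds_zero
  have hgeom : ∀ k, ∑ j ∈ Finset.range k, c ^ j = (c ^ k - 1) / (c - 1) :=
    fun k => geom_sum_eq hc.ne' k
  have hinv : Tendsto (fun k => 1 - (c⁻¹) ^ k) atTop (𝓝 1) := by
    simpa using (tendsto_pow_atTop_nhds_zero_of_lt_one (inv_nonneg.mpr hc0.le)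
      (inv_lt_one_of_one_lt₀ hc)).const_sub 1
  have hmain := (hs.add_const L).mul hinv
  rw [zero_add, mul_one] at hmain
  refine hmain.congr' ?_
  -- At `k = 0` the total weight vanishes and the average is not defined.
  filter_upwards [eventually_gt_atTop 0] with k hk
  have hck : c ^ k - 1 ≠ 0 := (sub_pos.mpr (one_lt_pow₀ hc hk.ne')).ne'
  have hck0 : c ^ k ≠ 0 := by positivity
  simp only [mul_sub, Finset.sum_sub_distrib, ← Finset.sum_mul, hgeom, inv_pow]
  field_simp
  ring

/-- The growth condition makes `a k / n^k` antitone, so it tends to its infimum. All values are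
finite because `a 0` is, which allows passage to the real statement. -/
theorem tendsto_geometric_mean_iInf {n : ℕ} (hn : 2 ≤ n) {a : ℕ → ℝ≥0∞} (h0 : a 0 ≠ ⊤)
    (ha : ∀ k, a (k + 1) ≤ n * a k) :
    Tendsto (fun k => ((n : ℝ≥0∞) - 1) * ((∑ j ∈ Finset.range k, a j) / (n : ℝ≥0∞) ^ k)) atTop
      (𝓝 (⨅ k, a k / (n : ℝ≥0∞) ^ k)) := by
  have hn0 : (n : ℝ≥0∞) ≠ 0 := by exact_mod_cast (by omega : n ≠ 0)
  have hnt : (n : ℝ≥0∞) ≠ ⊤ := ENNReal.natCast_ne_top n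
  have hat : ∀ k, a k ≠ ⊤ := by
    intro k
    induction k with
    | zero => exact h0
    | succ k ih => exact ne_top_of_le_ne_top (ENNReal.mul_ne_top hnt ih) (ha k)
  have hanti : Antitone fun k => a k / (n : ℝ≥0∞) ^ k := by
    refine antitone_nat_of_succ_le fun k => ?_
    refine (ENNReal.div_le_div_right (ha k) _).trans_eq ?_
    rw [pow_succ', ENNReal.mul_div_mul_left _ _ hn0 hnt]
  have hbt : ∀ k, a k / (n : ℝ≥0∞) ^ k ≠ ⊤ := fun k =>
    ENNReal.div_ne_top (hat k) (pow_ne_zero _ hn0)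
  have hL : (⨅ k, a k / (n : ℝ≥0∞) ^ k) ≠ ⊤ := ne_top_of_le_ne_top (hbt 0) (iInf_le _ 0)
  have hlim := (ENNReal.tendsto_toReal hL).comp (tendsto_atTop_iInf hanti)
  have hreal := tendsto_geometric_mean (c := n) (by exact_mod_cast hn) hlim
  rw [← ENNReal.ofReal_toReal hL]
  refine (ENNReal.tendsto_ofReal hreal).congr fun k => ?_
  have hn1 : (1 : ℝ) ≤ n := by exact_mod_cast (by omega : 1 ≤ n)
  have hnr : (0 : ℝ) < n := by linarith
  rw [ENNReal.ofReal_mul (by linarith), ENNReal.ofReal_sub _ zero_le_one,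
    ENNReal.ofReal_natCast, ENNReal.ofReal_one, ENNReal.ofReal_div_of_pos (by positivity),
    ENNReal.ofReal_pow hnr.le, ENNReal.ofReal_natCast]
  congr 2
  have hterm : ∀ j, (n : ℝ) ^ j * ((ENNReal.toReal ∘ fun k => a k / (n : ℝ≥0∞) ^ k) j) =
      (a j).toReal := by
    intro j
    simp only [Function.comp_apply, ENNReal.toReal_div, ENNReal.toReal_pow, ENNReal.toReal_natCast]
    field_simp
  simp_rw [hterm]
  rw [← ENNReal.toReal_sum fun j _ => hat j, ENNReal.ofReal_toReal]
  exact (ENNReal.sum_ne_top).mpr fun j _ => hat j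

theorem IsRowContraction.tendsto_curvatureSeq {A : Fin n → H →L[ℂ] H} (hn : 2 ≤ n)
    (hA : IsRowContraction A) (hD : trace (defect A) ≠ ⊤) :
    Tendsto (curvatureSeq A) atTop
      (𝓝 (⨅ k, trace ((cpMap A)^[k] (defect A)) / (n : ℝ≥0∞) ^ k)) := by
  refine (tendsto_geometric_mean_iInf hn hD fun k => ?_).congr fun k => ?_
  · rw [Function.iterate_succ_apply']
    exact hA.trace_cpMap_le (iterate_cpMap_nonneg A k hA.defect_nonneg)
  · rw [curvatureSeq, one_sub_iterate_cpMap,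
      trace_sum _ _ fun j _ => iterate_cpMap_nonneg A j hA.defect_nonneg]

end RowContraction

namespace RowContraction

variable {H : Type*} [NormedAddCommGroup H] [InnerProductSpace ℂ H] [CompleteSpace H] {n : ℕ}

/-! ### Positive contractions of finite rank -/

/-- Compressing `T ≤ 1` by the range projection `P` gives `T = P T P ≤ P`. -/
theorem le_starProjection_range {T : H →L[ℂ] H} (h0 : 0 ≤ T) (h1 : T ≤ 1)
    [FiniteDimensional ℂ T.range] : T ≤ T.range.starProjection := by
  set P := T.range.starProjection with hP
  have hPs : star P = P := (isStarProjection_starProjection (U := T.range)).isSelfAdjoint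
  have hPT : P * T = T := by
    ext x
    exact Submodule.starProjection_eq_self_iff.mpr ⟨x, rfl⟩
  have hTP : T * P = T := by
    have h := congrArg star hPT
    rwa [star_mul, hPs, (IsSelfAdjoint.of_nonneg h0).star_eq] at h
  have h := star_right_conjugate_le_conjugate h1 P
  rwa [hPT, hPs, hTP, mul_one, (Submodule.isIdempotentElem_starProjection T.range).eq] at h

/-- Finiteness allows cancellation, so `T - S ≥ 0` has trace zero, and the trace is faithful. -/
theorem eq_of_le_of_trace_eq {S T : H →L[ℂ] H} (hS : 0 ≤ S) (hST : S ≤ T)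
    (h : trace S = trace T) (hT : trace T ≠ ⊤) : S = T := by
  have h1 := trace_add hS (sub_nonneg.mpr hST)
  rw [add_sub_cancel, h] at h1
  have h2 : trace (T - S) = 0 := (ENNReal.add_right_inj hT).mp (by rw [← h1, add_zero])
  exact (sub_eq_zero.mp (eq_zero_of_trace_eq_zero (sub_nonneg.mpr hST) h2)).symm

/-! ### The family of vectors `A_w c_i` -/

section Wandering

variable {M : Submodule ℂ H} [FiniteDimensional ℂ M] {r : ℕ}

/-- The trace is the sum of `‖A_w c_i‖²` over the `n^k r` pairs with `|w| = k`. Each term is at most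
one and the total is `n^k r`, so no term can be smaller. -/
theorem IsRowContraction.norm_wordProd_apply_eq_one {A : Fin n → H →L[ℂ] H}
    (hA : IsRowContraction A) (c : OrthonormalBasis (Fin r) ℂ M)
    (h : ∀ k, trace ((cpMap A)^[k] M.starProjection) = (n : ℝ≥0∞) ^ k * r)
    (w : FreeMonoid (Fin n)) (i : Fin r) : ‖wordProd A w (c i)‖ = 1 := by
  obtain ⟨k, v, rfl⟩ := exists_tupleWord w
  have hP : 0 ≤ M.starProjection := by
    rw [ContinuousLinearMap.nonneg_iff_isPositive]
    exact .of_isStarProjection isStarProjection_starProjection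
  have hle : ∀ p : (Fin k → Fin n) × Fin r, ‖wordProd A (tupleWord p.1) (c p.2)‖ ^ 2 ≤ 1 := by
    intro p
    have h1 := (wordProd A (tupleWord p.1)).le_of_opNorm_le (hA.norm_wordProd_le_one _) (c p.2)
    have h2 : ‖(c p.2 : H)‖ = 1 := c.orthonormal.1 p.2
    rw [h2, mul_one] at h1
    exact pow_le_one₀ (norm_nonneg _) h1
  have hsum := h k
  rw [iterate_cpMap, trace_sum _ _ fun v _ => star_mul_mul_nonneg hP _] at hsum
  simp_rw [trace_conj_starProjection c] at hsum
  rw [← Fintype.sum_prod_type' (f := fun v i =>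
      ENNReal.ofReal (‖wordProd A (tupleWord v) (c i)‖ ^ 2)),
    ← ENNReal.ofReal_sum_of_nonneg fun p _ => by positivity] at hsum
  have hreal : ∑ p : (Fin k → Fin n) × Fin r, ‖wordProd A (tupleWord p.1) (c p.2)‖ ^ 2 =
      ∑ p : (Fin k → Fin n) × Fin r, (1 : ℝ) := by
    have h1 := congrArg ENNReal.toReal hsum
    rw [ENNReal.toReal_ofReal (Finset.sum_nonneg fun p _ => by positivity)] at h1
    simpa using h1
  have h1 := (Finset.sum_eq_sum_iff_of_le fun p _ => hle p).mp hreal (v, i) (Finset.mem_univ _)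
  exact (pow_eq_one_iff_of_nonneg (norm_nonneg _) two_ne_zero).mp h1

/-- The words of length `k` contribute `⟪x, Φ^k(D) x⟫`. The partial sums telescope to `⟪x, x -
Φ^k(I) x⟫`, and purity removes the second term in the limit. -/
theorem IsPure.tsum_norm_inner_wordProd {A : Fin n → H →L[ℂ] H} (hA : IsRowContraction A)
    (hp : IsPure A) (c : OrthonormalBasis (Fin r) ℂ M) (hD : defect A = M.starProjection) (x : H) :
    ∑' p : FreeMonoid (Fin n) × Fin r, ENNReal.ofReal (‖⟪wordProd A p.1 (c p.2), x⟫_ℂ‖ ^ 2) =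
      ENNReal.ofReal (‖x‖ ^ 2) := by
  have hterm : ∀ k : ℕ, ∑ v : Fin k → Fin n, ∑' i : Fin r,
      ENNReal.ofReal (‖⟪wordProd A (tupleWord v) (c i), x⟫_ℂ‖ ^ 2) =
        ENNReal.ofReal (⟪x, (cpMap A)^[k] (defect A) x⟫_ℂ).re := by
    intro k
    rw [hD, iterate_cpMap, sum_apply, inner_sum, Complex.re_sum]
    simp_rw [re_inner_conj_starProjection c, tsum_fintype]
    rw [ENNReal.ofReal_sum_of_nonneg fun v _ => Finset.sum_nonneg fun i _ => by positivity]
    refine Finset.sum_congr rfl fun v _ => ?_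
    rw [ENNReal.ofReal_sum_of_nonneg fun i _ => by positivity]
  rw [ENNReal.tsum_prod', tsum_freeMonoid, tsum_congr hterm]
  refine tendsto_nhds_unique (ENNReal.tendsto_nat_tsum _) ?_
  have hpartial : ∀ k : ℕ, ∑ j ∈ Finset.range k,
      ENNReal.ofReal (⟪x, (cpMap A)^[j] (defect A) x⟫_ℂ).re =
        ENNReal.ofReal (⟪x, x - (cpMap A)^[k] 1 x⟫_ℂ).re := by
    intro k
    rw [← ENNReal.ofReal_sum_of_nonneg fun j _ =>
        re_inner_nonneg (iterate_cpMap_nonneg A j hA.defect_nonneg) x,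
      ← Complex.re_sum, ← inner_sum, ← sum_apply, ← one_sub_iterate_cpMap]
    rfl
  simp_rw [hpartial]
  have hlim : Tendsto (fun k => (⟪x, x - (cpMap A)^[k] 1 x⟫_ℂ).re) atTop (𝓝 (‖x‖ ^ 2)) := by
    have h1 := (Complex.continuous_re.tendsto _).comp
      ((tendsto_const_nhds (x := x)).inner (𝕜 := ℂ) ((hp x).const_sub x))
    rw [sub_zero] at h1
    rwa [show (⟪x, x⟫_ℂ).re = ‖x‖ ^ 2 from inner_self_eq_norm_sq (𝕜 := ℂ) x] at h1
  exact ENNReal.tendsto_ofReal hlim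

end Wandering

/-- A family of unit vectors satisfying Parseval's identity is a Hilbert basis. -/
theorem exists_hilbertBasis_of_parseval {ι : Type*} {v : ι → H} (hv : ∀ i, ‖v i‖ = 1)
    (h : ∀ x, ∑' i, ENNReal.ofReal (‖⟪v i, x⟫_ℂ‖ ^ 2) = ENNReal.ofReal (‖x‖ ^ 2)) :
    ∃ b : HilbertBasis ι ℂ H, ⇑b = v := by
  classical
  have hon : Orthonormal ℂ v := by
    refine ⟨hv, fun i j hij => ?_⟩
    -- Parseval at `v j` has total one, already used up by the term of index `j`; hence the term of
    -- index `i` vanishes.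
    have h1 := ENNReal.sum_le_tsum (f := fun i => ENNReal.ofReal (‖⟪v i, v j⟫_ℂ‖ ^ 2)) {j, i}
    rw [h, Finset.sum_pair hij.symm, inner_self_eq_norm_sq_to_K, hv] at h1
    have h2 : ENNReal.ofReal (‖⟪v i, v j⟫_ℂ‖ ^ 2) ≤ 0 := by
      refine (ENNReal.add_le_add_iff_left ENNReal.one_ne_top).mp ?_
      simpa using h1
    have h3 := ENNReal.ofReal_eq_zero.mp (le_zero_iff.mp h2)
    simpa using le_antisymm h3 (by positivity)
  have hbot : (Submodule.span ℂ (Set.range v))ᗮ = ⊥ := by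
    rw [Submodule.eq_bot_iff]
    intro x hx
    have h0 : ∀ i, ⟪v i, x⟫_ℂ = 0 := fun i =>
      (Submodule.mem_orthogonal _ _).mp hx _ (Submodule.subset_span ⟨i, rfl⟩)
    have h1 := (h x).symm
    simp only [h0, norm_zero, ne_eq, OfNat.ofNat_ne_zero, not_false_eq_true, zero_pow,
      ENNReal.ofReal_zero, tsum_zero, ENNReal.ofReal_eq_zero] at h1
    simpa using le_antisymm h1 (by positivity)
  exact ⟨.mkOfOrthogonalEqBot hon hbot, HilbertBasis.coe_mkOfOrthogonalEqBot hon hbot⟩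

theorem ext_hilbertBasis {ι K : Type*} [NormedAddCommGroup K] [InnerProductSpace ℂ K]
    (b : HilbertBasis ι ℂ H) {S T : H →L[ℂ] K} (h : ∀ i, S (b i) = T (b i)) : S = T := by
  refine ContinuousLinearMap.ext_on
    (Submodule.dense_iff_topologicalClosure_eq_top.mpr b.dense_span) ?_
  rintro _ ⟨i, rfl⟩
  exact h i

/-! ### Bases of Fock space and of its multiples -/

theorem inner_xi_left (w : FreeMonoid (Fin n)) (x : Fock n) : ⟪xi w, x⟫_ℂ = x w := by
  classical
  rw [xi, lp.inner_single_left]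
  simp

/-- The standard Hilbert basis of the direct sum of `r` copies of Fock space. -/
theorem exists_fock_hilbertBasis (n r : ℕ) :
    ∃ b : HilbertBasis (FreeMonoid (Fin n) × Fin r) ℂ (PiLp 2 fun _ : Fin r => Fock n),
      ∀ w i, b (w, i) = WithLp.toLp 2 (Pi.single i (xi w)) := by
  classical
  set v : FreeMonoid (Fin n) × Fin r → PiLp 2 fun _ : Fin r => Fock n :=
    fun p => WithLp.toLp 2 (Pi.single p.2 (xi p.1)) with hv
  -- Pairing with `v p` reads off a coordinate, which settles both orthonormality and completeness.
  have hinner : ∀ p (x : PiLp 2 fun _ : Fin r => Fock n), ⟪v p, x⟫_ℂ = x p.2 p.1 := by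
    intro p x
    rw [PiLp.inner_apply, Finset.sum_eq_single p.2]
    · simp [hv, inner_xi_left]
    · intro j _ hj
      simp [hv, hj]
    · simp
  have hon : Orthonormal ℂ v := by
    rw [orthonormal_iff_ite]
    rintro ⟨w, i⟩ ⟨w', j⟩
    rw [hinner]
    by_cases hij : i = j
    · subst hij
      have := orthonormal_iff_ite.mp (xi_orthonormal (n := n)) w w'
      rw [inner_xi_left] at this
      simpa [hv] using this
    · simp [hv, hij]
  have hbot : (Submodule.span ℂ (Set.range v))ᗮ = ⊥ := by
    rw [Submodule.eq_bot_iff]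
    intro x hx
    ext i w
    have h0 : ⟪v (w, i), x⟫_ℂ = 0 :=
      (Submodule.mem_orthogonal _ _).mp hx _ (Submodule.subset_span ⟨_, rfl⟩)
    rw [hinner] at h0
    exact h0
  refine ⟨.mkOfOrthogonalEqBot hon hbot, fun w i => ?_⟩
  rw [HilbertBasis.coe_mkOfOrthogonalEqBot]

/-- The unitary sends `A_w c_i` to `ξ_w` in the `i`-th copy; on both sides the `j`-th operator
prefixes the letter `j` to `w`. -/
theorem unitarilyEquivalent_of_hilbertBasis {A : Fin n → H →L[ℂ] H} {r : ℕ} {c : Fin r → H}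
    (b : HilbertBasis (FreeMonoid (Fin n) × Fin r) ℂ H)
    (hb : ∀ w i, b (w, i) = wordProd A w (c i)) :
    UnitarilyEquivalent A (fun i : Fin n => ampliation r (creation i)) := by
  classical
  obtain ⟨e, he⟩ := exists_fock_hilbertBasis n r
  set U := b.repr.trans e.repr.symm with hU
  have hUb : ∀ p, U (b p) = e p := by
    intro p
    rw [hU, LinearIsometryEquiv.trans_apply, b.repr_self, e.repr_symm_single]
  refine ⟨U, fun j x => ?_⟩
  have h : (U : H →L[ℂ] _) ∘L A j = ampliation r (creation j) ∘L (U : H →L[ℂ] _) := by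
    refine ext_hilbertBasis b ?_
    rintro ⟨w, i⟩
    have h1 : A j (b (w, i)) = b (FreeMonoid.of j * w, i) := by
      rw [hb, hb, wordProd_of_mul]
      rfl
    change U (A j (b (w, i))) = ampliation r (creation j) (U (b (w, i)))
    rw [h1, hUb, hUb, he, he]
    ext1 k
    rw [ampliation_apply]
    by_cases hk : k = i
    · subst hk
      simp [creation_xi]
    · simp [hk]
  exact DFunLike.congr_fun h x

/-! ### Isometry relations and the defect of a free tuple -/

theorem star_creation_mul_creation (i j : Fin n) :
    star (creation i) * creation j = if i = j then 1 else 0 := by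
  classical
  obtain ⟨e, he⟩ : ∃ e : HilbertBasis (FreeMonoid (Fin n)) ℂ (Fock n), ⇑e = xi := by
    have hbot : (Submodule.span ℂ (Set.range (xi (n := n))))ᗮ = ⊥ := by
      rw [Submodule.eq_bot_iff]
      intro x hx
      ext w
      rw [← inner_xi_left]
      exact (Submodule.mem_orthogonal _ _).mp hx _ (Submodule.subset_span ⟨_, rfl⟩)
    exact ⟨.mkOfOrthogonalEqBot xi_orthonormal hbot, HilbertBasis.coe_mkOfOrthogonalEqBot _ _⟩
  refine ext_hilbertBasis e fun w => ?_
  refine lp.ext (funext fun v => ?_)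
  have h : ∀ v w : FreeMonoid (Fin n), FreeMonoid.of i * v = FreeMonoid.of j * w ↔
      i = j ∧ v = w := fun v w => List.cons_eq_cons
  rw [← inner_xi_left, ← inner_xi_left, he, mul_apply_eq_comp, ContinuousLinearMap.star_eq_adjoint,
    ContinuousLinearMap.adjoint_inner_right, creation_xi, creation_xi,
    orthonormal_iff_ite.mp xi_orthonormal]
  by_cases hij : i = j
  · simp [hij, orthonormal_iff_ite.mp xi_orthonormal]
  · simp [h, hij]

theorem IsFree.star_mul {A : Fin n → H →L[ℂ] H} (hA : IsFree A) (i j : Fin n) :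
    star (A i) * A j = if i = j then 1 else 0 := by
  obtain ⟨α, -, U, hU⟩ := hA
  ext x
  refine ext_inner_left ℂ fun y => ?_
  rw [mul_apply_eq_comp, ContinuousLinearMap.star_eq_adjoint,
    ContinuousLinearMap.adjoint_inner_right, ← U.inner_map_map, hU, hU, PiLp.inner_apply]
  have h : ∀ k, ⟪creation i (U y k), creation j (U x k)⟫_ℂ =
      if i = j then ⟪U y k, U x k⟫_ℂ else 0 := by
    intro k
    rw [← ContinuousLinearMap.adjoint_inner_right, ← ContinuousLinearMap.star_eq_adjoint,
      ← mul_apply_eq_comp, star_creation_mul_creation]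
    split_ifs <;> simp
  simp_rw [ampliation_apply, h]
  split_ifs
  · rw [← PiLp.inner_apply, U.inner_map_map]
    rfl
  · simp

/-- The relations give `D A_j = 0`, so `D` annihilates `∑ A_i A_i*` and `D² = D`. -/
theorem isStarProjection_defect {A : Fin n → H →L[ℂ] H}
    (hA : ∀ i j, star (A i) * A j = if i = j then 1 else 0) : IsStarProjection (defect A) := by
  have hs : IsSelfAdjoint (defect A) := by simp [IsSelfAdjoint, defect]
  refine ⟨?_, hs⟩
  have h0 : ∀ j, defect A * A j = 0 := by
    intro j
    rw [defect, sub_mul, one_mul, Finset.sum_mul, sub_eq_zero]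
    simp_rw [mul_assoc, hA]
    simp
  have h : defect A * (1 - ∑ i, A i * star (A i)) = defect A := by
    rw [mul_sub, mul_one, Finset.mul_sum]
    simp_rw [← mul_assoc, h0]
    simp
  exact h

end RowContraction

/-! ### The main theorem -/

theorem mainTheorem1 {H : Type*} [NormedAddCommGroup H] [InnerProductSpace ℂ H] [CompleteSpace H]
    (n : ℕ) (hn : 2 ≤ n) (A : Fin n → H →L[ℂ] H)
    (hcontr : RowContraction.IsRowContraction A)
    (hpure : RowContraction.IsPure A)
    (hne : A ≠ 0)
    (hrank : RowContraction.pureRank A < ⊤) :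
    Tendsto (RowContraction.curvatureSeq A) atTop (𝓝 (RowContraction.curvature A)) ∧
      (RowContraction.curvature A = (RowContraction.pureRank A : ℝ≥0∞) ↔
        RowContraction.IsFree A) := by
  open RowContraction in
  set D : H →L[ℂ] H := defect A with hD
  have hfin : FiniteDimensional ℂ D.range := by
    by_contra h
    refine hrank.ne (Cardinal.toENat_eq_top.mpr ?_)
    exact not_lt.mp fun hlt => h (Module.rank_lt_aleph0_iff.mp hlt)
  set r := Module.finrank ℂ D.range with hr
  have hpr : pureRank A = r := by
    change Cardinal.toENat (Module.rank ℂ D.range) = r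
    rw [← Module.finrank_eq_rank, Cardinal.toENat_nat]
  have c : OrthonormalBasis (Fin r) ℂ D.range := stdOrthonormalBasis ℂ D.range
  have hD0 : 0 ≤ D := hcontr.defect_nonneg
  have hDP : D ≤ D.range.starProjection := le_starProjection_range hD0 (defect_le_one A)
  have hPr := trace_starProjection c
  have hDr : trace D ≤ r := (trace_mono hD0 hDP).trans_eq hPr
  have hn0 : (n : ℝ≥0∞) ≠ 0 := by exact_mod_cast (by omega : n ≠ 0)
  have hnk0 : ∀ k, (n : ℝ≥0∞) ^ k ≠ 0 := fun k => pow_ne_zero k hn0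
  have hnkt : ∀ k, (n : ℝ≥0∞) ^ k ≠ ⊤ := fun k => ENNReal.pow_ne_top (ENNReal.natCast_ne_top n)
  have hlim := hcontr.tendsto_curvatureSeq hn
    (ne_top_of_le_ne_top (ENNReal.natCast_ne_top r) hDr)
  have hcurv : curvature A = ⨅ k, trace ((cpMap A)^[k] D) / (n : ℝ≥0∞) ^ k := hlim.limUnder_eq
  refine ⟨hcurv ▸ hlim, ?_⟩
  rw [hpr, ENat.toENNReal_coe]
  constructor
  · intro hK
    -- The infimum equals `r`, so every ratio is at least `r`; contractivity and `tr D ≤ r` give the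
    -- opposite bound.
    have hlow : ∀ k, (n : ℝ≥0∞) ^ k * r ≤ trace ((cpMap A)^[k] D) := by
      intro k
      rw [mul_comm, ← ENNReal.le_div_iff_mul_le (Or.inl (hnk0 k)) (Or.inl (hnkt k)), ← hK, hcurv]
      exact iInf_le _ k
    have hup : ∀ k, trace ((cpMap A)^[k] D) ≤ (n : ℝ≥0∞) ^ k * r := by
      intro k
      induction k with
      | zero => simpa using hDr
      | succ k ih =>
        rw [Function.iterate_succ_apply', pow_succ', mul_assoc]
        exact (hcontr.trace_cpMap_le (iterate_cpMap_nonneg A k hD0)).trans (by gcongr)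
    have htr : ∀ k, trace ((cpMap A)^[k] D) = (n : ℝ≥0∞) ^ k * r :=
      fun k => le_antisymm (hup k) (hlow k)
    have hproj : D = D.range.starProjection :=
      eq_of_le_of_trace_eq hD0 hDP (by simpa [hPr] using htr 0)
        (by rw [hPr]; exact ENNReal.natCast_ne_top r)
    have hunit := hcontr.norm_wordProd_apply_eq_one c fun k => by rw [← hproj]; exact htr k
    obtain ⟨b, hb⟩ := exists_hilbertBasis_of_parseval
      (v := fun p : FreeMonoid (Fin n) × Fin r => wordProd A p.1 (c p.2))
      (fun p => hunit p.1 p.2) (hpure.tsum_norm_inner_wordProd hcontr c hproj)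
    -- If `r = 0` the basis is empty, so `H` is zero and `A = 0`, contrary to assumption.
    refine ⟨r, Nat.pos_of_ne_zero fun hr0 => hne ?_,
      unitarilyEquivalent_of_hilbertBasis (c := fun i => (c i : H)) b fun w i => by rw [hb]⟩
    have hempty : IsEmpty (Fin r) := by rw [hr0]; infer_instance
    funext i
    refine ext_hilbertBasis b fun p => isEmptyElim p.2
  · intro hfree
    have hstar := hfree.star_mul
    obtain ⟨_, hproj⟩ := isStarProjection_iff_eq_starProjection_range.mp
      (isStarProjection_defect hstar)
    -- The factor `n^k` cancels exactly, leaving `tr D`, which is the rank because `D` is a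
    -- projection.
    have htr : ∀ k, trace ((cpMap A)^[k] D) / (n : ℝ≥0∞) ^ k = r := by
      intro k
      rw [trace_iterate_cpMap_of_isometry (fun i => by simp [hstar]) hD0, mul_comm,
        ENNReal.mul_div_cancel_right (hnk0 k) (hnkt k), ← hPr]
      exact congrArg trace hproj
    rw [hcurv]
    simp_rw [htr]
    exact ciInf_const
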